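/- **Definitions.** A *Lorentzian metric space* $(X,d)$ is a set $X$ with a function $d:X\times X\to[0,\infty)$ such that (i) $d(x,z)\ge d(x,y)+d(y,z)$ whenever $d(x,y)>0$ and $d(y,z)>0$; (ii) there is a topology on $X$ for which $d$ is continuous (with respect to the product topology) and for which the set $\{(u,v): d(u,v)\ge\epsilon\}\cap\big(\overline{I(x,y)}\times\overline{I(x,y)}\big)$ is compact for all $x,y\in X$ and $\epsilon>0$; (iii) for any $x\neq y$ in $X$ there is $z\in X$ with $d(x,z)\ne d(y,z)$ or $d(z,x)\neq d(z,y)$. Here, for $A\subset X$ and $\epsilon>0$, $$I(A)=\{x: \exists\, p,q\in A,\ d(p,x)>0,\ d(x,q)>0\},\qquad I_\epsilon(A)=\{x: \exists\, p,q\in A,\ d(p,x)\ge\epsilon,\ d(x,q)\ge\epsilon\},$$ and the braces are dropped for finite $A$. A *sequenced Lorentzian metric space* $(X,d,\{p^k\}_{k\ge1})$ is a Lorentzian metric space with a sequence of points such that $X=I(\{p^k: k\geq 1\})$; the topology in (ii) is then unique, and $X$ carries this topology. Two such spaces $(X,d,\{p^k\})$ and $(X',d',\{p'^k\})$ are *isomorphic*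 if there is a bijection $\phi:X\to X'$ with $d'(\phi(x),\phi(y))=d(x,y)$ for all $x,y\in X$ and $\phi(p^k)=p'^k$ for all $k$. Put $X^m=\overline{I(p^1,\dots,p^m)}\cup\{p^1,\dots,p^m\}$. For an integer $m\ge1$ and $\epsilon>0$, an *$(m,\epsilon)$ quasi-correspondence* between $X$ and $X'$ is a compact set $R\subset X^m\times X'^m$ such that $I_\epsilon(p^1,\dots,p^m)$ is contained in the projection of $R$ to $X$, $I_\epsilon(p'^1,\dots,p'^m)$ is contained in the projection of $R$ to $X'$, $\sup_{(x,x'),(y,y')\in R}|d(x,y)-d'(x',y')|<\epsilon$, and $(p^r,p'^r)\in R$ for $r=1,\dots,m$. A sequence $X_n$ of sequenced Lorentzian metric spaces *GH-converges* to a sequenced Lorentzian metric space $X$ if for every $m\ge1$ and $\delta>0$ there is $n_0$ such that for every $n\ge n_0$ there is an $(m,\delta)$ quasi-correspondence between $X_n$ and $X$. **Theorem.** (1) Two sequenced Lorentzian metric spaces $X$ and $X'$ are isomorphic if and only if for every integer $m\ge 1$ and every $\epsilon>0$ there is an $(m,\epsilon)$ quasi-correspondence between them. (2) If a sequence of sequenced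 Lorentzian metric spaces GH-converges both to the sequenced Lorentzian metric space $X$ and to the sequenced Lorentzian metric space $X'$, then $X$ and $X'$ are isomorphic (as sequenced Lorentzian metric spaces). -/

import Mathlib

universe u v w

namespace LorentzianGH

open Set Topology
open scoped ENNReal

section Distance

variable {X : Type u}

/-- The chronological convex hull `I(A) = ⋃_{p, q ∈ A} I⁺(p) ∩ I⁻(q)`, where `x ≪ y` means
`0 < d x y`. For `A = {p, q}` it is the chronological diamond of `p` and `q`. -/
def chronHull (d : X → X → ℝ) (A : Set X) : Set X :=
  {x | ∃ p ∈ A, ∃ q ∈ A, 0 < d p x ∧ 0 < d x q}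

/-- The hull `I_ε(A)`, formed as `I(A)` but with the relation `I_ε = {(x, y) | d(x, y) ≥ ε}`
in the place of the chronological relation. -/
def epsHull (d : X → X → ℝ) (ε : ℝ) (A : Set X) : Set X :=
  {x | ∃ p ∈ A, ∃ q ∈ A, ε ≤ d p x ∧ ε ≤ d x q}

/-- The topology `T` is as required in the definition of a Lorentzian metric space: `d` is
continuous for the product topology, and for all `x, y` and all `ε > 0` the set
`I_ε ∩ (closure I(x, y) × closure I(x, y))` is compact. -/
def IsCompatibleTopology (d : X → X → ℝ) (T : TopologicalSpace X) : Prop :=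
  letI := T
  Continuous (fun a : X × X => d a.1 a.2) ∧
    ∀ (x y : X) (ε : ℝ), 0 < ε →
      IsCompact ({a : X × X | ε ≤ d a.1 a.2} ∩
        closure (chronHull d {x, y}) ×ˢ closure (chronHull d {x, y}))

theorem isCompact_closure_diamond {d : X → X → ℝ}
    (htri : ∀ x y z, 0 < d x y → 0 < d y z → d x y + d y z ≤ d x z)
    (hfut : ∀ x, ∃ q, 0 < d x q) [T : TopologicalSpace X] (hT : IsCompatibleTopology d T)
    (p q : X) (hpq : 0 < d p q) : IsCompact (closure {y | 0 < d p y ∧ 0 < d y q}) := by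
  obtain ⟨hc, hK⟩ := hT
  obtain ⟨q', hq'⟩ := hfut q
  obtain ⟨q'', hq''⟩ := hfut q'
  have h1 : 0 < d q q'' := by have := htri _ _ _ hq' hq''; linarith
  have h2 : 0 < d p q' := by have := htri _ _ _ hpq hq'; linarith
  have hsub : {y | 0 < d p y ∧ 0 < d y q} ⊆ chronHull d {p, q''} := fun y hy =>
    ⟨p, by simp, q'', by simp, hy.1, by have := htri _ _ _ hy.2 h1; linarith [hy.2]⟩
  refine ((hK p q'' _ hq').image continuous_fst).of_isClosed_subset isClosed_closure ?_
  intro y hy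
  refine ⟨(y, q'), ⟨?_, closure_mono hsub hy, subset_closure ?_⟩, rfl⟩
  · have hcl : IsClosed {y | d q q' ≤ d y q'} :=
      isClosed_le continuous_const (hc.comp (continuous_id.prodMk continuous_const))
    exact closure_minimal (fun z hz => by
      have := htri _ _ _ hz.2 hq'
      have := hz.2
      change 0 < d z q at this; change d q q' ≤ d z q'
      linarith) hcl hy
  · exact ⟨p, by simp, q'', by simp, h2, hq''⟩

theorem compatible_le {d : X → X → ℝ}
    (htri : ∀ x y z, 0 < d x y → 0 < d y z → d x y + d y z ≤ d x z)
    (hdist : ∀ x y, x ≠ y → ∃ z, d x z ≠ d y z ∨ d z x ≠ d z y)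
    (hpast : ∀ x, ∃ p, 0 < d p x) (hfut : ∀ x, ∃ q, 0 < d x q)
    {T₁ T₂ : TopologicalSpace X} (h₁ : IsCompatibleTopology d T₁)
    (h₂ : IsCompatibleTopology d T₂) : T₁ ≤ T₂ := by
  have key : ∀ T : TopologicalSpace X, IsCompatibleTopology d T → ∀ (z : X) (S : Set ℝ),
      IsOpen S → IsOpen[T] {y | d y z ∈ S} ∧ IsOpen[T] {y | d z y ∈ S} := by
    intro T hT z S hS
    exact ⟨hS.preimage (hT.1.comp (continuous_id.prodMk continuous_const)),
      hS.preimage (hT.1.comp (continuous_const.prodMk continuous_id))⟩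
  have sep : ∀ x y : X, x ≠ y → ∃ U V : Set X, IsOpen[T₁] U ∧ IsOpen[T₂] V ∧ x ∈ U ∧ y ∈ V ∧
      Disjoint U V := by
    intro x y hxy
    obtain ⟨z, hz | hz⟩ := hdist x y hxy
    · obtain ⟨A, B, hA, hB, hx, hy, hAB⟩ := t2_separation hz
      exact ⟨_, _, (key T₁ h₁ z A hA).1, (key T₂ h₂ z B hB).1, hx, hy,
        hAB.preimage (fun y => d y z)⟩
    · obtain ⟨A, B, hA, hB, hx, hy, hAB⟩ := t2_separation hz
      exact ⟨_, _, (key T₁ h₁ z A hA).2, (key T₂ h₂ z B hB).2, hx, hy,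
        hAB.preimage (fun y => d z y)⟩
  intro O hO
  refine (@isOpen_iff_forall_mem_open X T₁ O).2 fun x hx => ?_
  obtain ⟨p, hp⟩ := hpast x
  obtain ⟨q, hq⟩ := hfut x
  have hpq : 0 < d p q := by have := htri _ _ _ hp hq; linarith
  have hK := @isCompact_closure_diamond X d htri hfut T₂ h₂ p q hpq
  have hKO := @IsCompact.diff X T₂ _ _ hK hO
  have hind : ∃ U : Set X, IsOpen[T₁] U ∧ x ∈ U ∧
      Disjoint U (@closure X T₂ {y | 0 < d p y ∧ 0 < d y q} \ O) := by
    refine @IsCompact.induction_on X T₂ _ hKO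
      (fun S => ∃ U : Set X, IsOpen[T₁] U ∧ x ∈ U ∧ Disjoint U S) ?_ ?_ ?_ ?_
    · exact ⟨univ, @isOpen_univ X T₁, mem_univ _, disjoint_empty _⟩
    · rintro s t hst ⟨U, hU, hxU, hd⟩
      exact ⟨U, hU, hxU, hd.mono_right hst⟩
    · rintro s t ⟨U, hU, hxU, hd⟩ ⟨U', hU', hxU', hd'⟩
      exact ⟨U ∩ U', @IsOpen.inter X T₁ _ _ hU hU', ⟨hxU, hxU'⟩,
        disjoint_union_right.2 ⟨hd.mono_left inter_subset_left,
          hd'.mono_left inter_subset_right⟩⟩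
    · intro y hy
      obtain ⟨U, V, hU, hV, hxU, hyV, hd⟩ := sep x y (fun h => hy.2 (h ▸ hx))
      exact ⟨V, @mem_nhdsWithin_of_mem_nhds X T₂ _ _ _ (@IsOpen.mem_nhds X T₂ _ _ hV hyV),
        U, hU, hxU, hd⟩
  obtain ⟨U, hU, hxU, hd⟩ := hind
  refine ⟨U ∩ ({y | d p y ∈ Ioi 0} ∩ {y | d y q ∈ Ioi 0}), ?_,
    @IsOpen.inter X T₁ _ _ hU (@IsOpen.inter X T₁ _ _ (key T₁ h₁ p _ isOpen_Ioi).2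
      (key T₁ h₁ q _ isOpen_Ioi).1), hxU, hp, hq⟩
  rintro z ⟨hzU, hz1, hz2⟩
  by_contra hzO
  exact disjoint_left.1 hd hzU ⟨@subset_closure X T₂ _ _ ⟨hz1, hz2⟩, hzO⟩

end Distance

/-- A Lorentzian metric space: a set with a function `d` with values in `[0, ∞)` that
satisfies the reverse triangle inequality for chronologically related points, admits a
compatible topology, and distinguishes points. -/
structure LorentzianMetricSpace where
  carrier : Type u
  d : carrier → carrier → ℝ
  d_nonneg : ∀ x y, 0 ≤ d x y
  reverse_triangle : ∀ x y z, 0 < d x y → 0 < d y z → d x y + d y z ≤ d x z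
  exists_topology : ∃ T : TopologicalSpace carrier, IsCompatibleTopology d T
  distinguishes : ∀ x y, x ≠ y → ∃ z, d x z ≠ d y z ∨ d z x ≠ d z y

/-- A sequenced Lorentzian metric space: a Lorentzian metric space with a sequence of points
whose range `G` is a generating set, that is, `I(G)` is the whole space. The sequence
`p¹, p², …` is indexed from `0` here: `pᵏ` is `seq (k - 1)`. -/
structure SequencedLorentzianMetricSpace extends LorentzianMetricSpace.{u} where
  seq : ℕ → carrier
  generates : chronHull d (range seq) = univ

namespace SequencedLorentzianMetricSpace

instance : CoeSort SequencedLorentzianMetricSpace.{u} (Type u) := ⟨fun X => X.carrier⟩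

/-- A sequenced Lorentzian metric space has exactly one compatible topology. -/
theorem existsUnique_topology (X : SequencedLorentzianMetricSpace.{u}) :
    ∃! T : TopologicalSpace X, IsCompatibleTopology X.d T := by
  have hgen : ∀ x, x ∈ chronHull X.d (range X.seq) := fun x => by rw [X.generates]; trivial
  have hpast : ∀ x, ∃ p, 0 < X.d p x := fun x =>
    let ⟨p, _, _, _, h, _⟩ := hgen x
    ⟨p, h⟩
  have hfut : ∀ x, ∃ q, 0 < X.d x q := fun x =>
    let ⟨_, _, q, _, _, h⟩ := hgen x
    ⟨q, h⟩
  obtain ⟨T, hT⟩ := X.exists_topology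
  exact ⟨T, hT, fun T' hT' => le_antisymm
    (compatible_le X.reverse_triangle X.distinguishes hpast hfut hT' hT)
    (compatible_le X.reverse_triangle X.distinguishes hpast hfut hT hT')⟩

/-- The topology of a sequenced Lorentzian metric space: its unique compatible topology. -/
noncomputable instance topology (X : SequencedLorentzianMetricSpace.{u}) :
    TopologicalSpace X :=
  Classical.choose X.existsUnique_topology

theorem topology_compatible (X : SequencedLorentzianMetricSpace.{u}) :
    IsCompatibleTopology X.d X.topology :=
  (Classical.choose_spec X.existsUnique_topology).1

/-- The set `{p¹, …, pᵐ}` of the first `m` points of the generating sequence. -/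
def initialPoints (X : SequencedLorentzianMetricSpace.{u}) (m : ℕ) : Set X :=
  {x | ∃ k < m, X.seq k = x}

/-- The set `Xᵐ`, the union of the closure of `I(p¹, …, pᵐ)` and `{p¹, …, pᵐ}`. -/
def region (X : SequencedLorentzianMetricSpace.{u}) (m : ℕ) : Set X :=
  closure (chronHull X.d (X.initialPoints m)) ∪ X.initialPoints m

/-- Two sequenced Lorentzian metric spaces are isomorphic if there is a distance preserving
bijection that maps the one generating sequence to the other, term by term. -/
def Isomorphic (X : SequencedLorentzianMetricSpace.{u})
    (X' : SequencedLorentzianMetricSpace.{v}) : Prop :=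
  ∃ φ : X → X', Function.Bijective φ ∧ (∀ x y, X'.d (φ x) (φ y) = X.d x y) ∧
    ∀ k, φ (X.seq k) = X'.seq k

/-- The distortion `sup {|d(x, y) - d'(x', y')| : (x, x'), (y, y') ∈ R}` of a relation, as an
element of `[0, ∞]`. -/
noncomputable def distortion (X : SequencedLorentzianMetricSpace.{u})
    (X' : SequencedLorentzianMetricSpace.{v}) (R : Set (X × X')) : ℝ≥0∞ :=
  ⨆ a ∈ R, ⨆ b ∈ R, ENNReal.ofReal |X.d a.1 b.1 - X'.d a.2 b.2|

/-- `R` is an `(m, ε)` quasi-correspondence between `X` and `X'`. -/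
structure IsQuasiCorrespondence (X : SequencedLorentzianMetricSpace.{u})
    (X' : SequencedLorentzianMetricSpace.{v}) (m : ℕ) (ε : ℝ) (R : Set (X × X')) : Prop where
  subset_region : R ⊆ X.region m ×ˢ X'.region m
  isCompact : IsCompact R
  epsHull_subset_fst : epsHull X.d ε (X.initialPoints m) ⊆ Prod.fst '' R
  epsHull_subset_snd : epsHull X'.d ε (X'.initialPoints m) ⊆ Prod.snd '' R
  distortion_lt : distortion X X' R < ENNReal.ofReal ε
  seq_mem : ∀ k < m, (X.seq k, X'.seq k) ∈ R

/-- Gromov-Hausdorff convergence of a sequence of sequenced Lorentzian metric spaces: for all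
`m ≥ 1` and `δ > 0` there is, for all sufficiently large `n`, an `(m, δ)` quasi-correspondence
between `Xₙ` and `X`. -/
def GHConverges (Xs : ℕ → SequencedLorentzianMetricSpace.{u})
    (X : SequencedLorentzianMetricSpace.{v}) : Prop :=
  ∀ (m : ℕ) (δ : ℝ), 1 ≤ m → 0 < δ →
    ∃ n₀ : ℕ, ∀ n ≥ n₀, ∃ R, IsQuasiCorrespondence (Xs n) X m δ R

end SequencedLorentzianMetricSpace

end LorentzianGH

/-!
The nontrivial implication of the first claim is proved by ultrafilter limits. Let `R n` be
relations between `X` and `X'` with distortion at most `1 / (n + 1)` that relate the first `n + 1`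
generators. A point `x` of `X` lies between two generators `p` and `q`, so it is eventually related
to some `u n`, and the small distortion keeps `u n` in the diamond of the two corresponding
generators of `X'`, whose closure is compact. Hence `u` converges along a nonprincipal ultrafilter
to a point `φ x` (`exists_tendsto_of_approx`). The same construction gives `ψ : X' → X`. By
continuity of both distances, limits of related sequences have equal distances
(`dist_eq_of_tendsto`). So `φ` preserves distances and is adjoint to `ψ`, that is,
`d' (φ x) y' = d x (ψ y')` and `d' y' (φ x) = d (ψ y') x`. Since distances distinguish points, it
follows formally that `φ` and `ψ` are mutually inverse and that `φ` maps generators to generators.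

This argument needs neither the compactness of the relations nor that they lie in the regions `Xᵐ`.
The remaining conditions, collected in `IsApproxCorrespondence`, are stable under composition up to
doubling the error; this gives uniqueness of limits.

Conversely, an isomorphism is continuous because the compatible topology is unique, so its graph
over the compact region `Xᵐ` is a quasi-correspondence with vanishing distortion.
-/

namespace LorentzianGH

namespace SequencedLorentzianMetricSpace

open Set Topology Filter

/-! ### Diamonds and regions -/

section Basic

variable (X : SequencedLorentzianMetricSpace.{u})

theorem exists_seq_bounds (x : X) : ∃ k l, 0 < X.d (X.seq k) x ∧ 0 < X.d x (X.seq l) := by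
  have hx : x ∈ chronHull X.d (range X.seq) := by rw [X.generates]; trivial
  obtain ⟨_, ⟨k, rfl⟩, _, ⟨l, rfl⟩, hk, hl⟩ := hx
  exact ⟨k, l, hk, hl⟩

theorem isCompact_closure_chronDiamond (p q : X) :
    IsCompact (closure {y | 0 < X.d p y ∧ 0 < X.d y q}) := by
  rcases ({y | 0 < X.d p y ∧ 0 < X.d y q} : Set X).eq_empty_or_nonempty with h | ⟨y, hy⟩
  · simp [h]
  · refine isCompact_closure_diamond X.reverse_triangle
      (fun x => (X.exists_seq_bounds x).elim fun _ ⟨l, _, hl⟩ => ⟨_, hl⟩)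
      X.topology_compatible p q ?_
    linarith [X.reverse_triangle _ _ _ hy.1 hy.2, hy.1, hy.2]

theorem finite_initialPoints (m : ℕ) : (X.initialPoints m).Finite :=
  (finite_Iio m).image X.seq

theorem isCompact_region (m : ℕ) : IsCompact (X.region m) := by
  have h : chronHull X.d (X.initialPoints m) =
      ⋃ p ∈ X.initialPoints m, ⋃ q ∈ X.initialPoints m, {y | 0 < X.d p y ∧ 0 < X.d y q} := by
    ext y; simp only [chronHull, mem_iUnion, exists_prop]; rfl
  have hf := X.finite_initialPoints m
  refine IsCompact.union ?_ hf.isCompact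
  rw [h, hf.closure_biUnion]
  refine hf.isCompact_biUnion fun p _ => ?_
  rw [hf.closure_biUnion]
  exact hf.isCompact_biUnion fun q _ => X.isCompact_closure_chronDiamond p q

theorem epsHull_subset_region {ε : ℝ} (hε : 0 < ε) (m : ℕ) :
    epsHull X.d ε (X.initialPoints m) ⊆ X.region m := by
  rintro x ⟨p, hp, q, hq, h1, h2⟩
  exact Or.inl (subset_closure ⟨p, hp, q, hq, hε.trans_le h1, hε.trans_le h2⟩)

theorem eq_of_dist_eq {x y : X} (h₁ : ∀ z, X.d x z = X.d y z)
    (h₂ : ∀ z, X.d z x = X.d z y) : x = y := by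
  by_contra hne
  obtain ⟨z, hz | hz⟩ := X.distinguishes x y hne
  exacts [hz (h₁ z), hz (h₂ z)]

end Basic

/-! ### Isomorphisms are homeomorphisms and induce quasi-correspondences -/

section Isomorphism

variable {X : SequencedLorentzianMetricSpace.{u}} {X' : SequencedLorentzianMetricSpace.{v}}

theorem image_chronHull (φ : X ≃ X') (hd : ∀ x y, X'.d (φ x) (φ y) = X.d x y) (A : Set X) :
    φ '' chronHull X.d A = chronHull X'.d (φ '' A) := by
  ext y
  obtain ⟨x, rfl⟩ := φ.surjective y
  rw [φ.injective.mem_set_image]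
  change (∃ p ∈ A, ∃ q ∈ A, _) ↔ ∃ p ∈ φ '' A, ∃ q ∈ φ '' A, _
  simp only [exists_mem_image, hd]

/-- A distance preserving bijection is continuous: the topology induced by it is compatible,
hence equal to the given one. -/
theorem continuous_of_dist_eq (φ : X ≃ X') (hd : ∀ x y, X'.d (φ x) (φ y) = X.d x y) :
    Continuous φ := by
  have key : IsCompatibleTopology X.d (X'.topology.induced φ) := by
    obtain ⟨hc, hK⟩ := X'.topology_compatible
    let T : TopologicalSpace X := X'.topology.induced φ
    -- From here on, `X` carries the induced topology.
    let e : @Homeomorph X X' T X'.topology :=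
      @Equiv.toHomeomorphOfIsInducing X X' T X'.topology φ ⟨rfl⟩
    have he : ∀ x, e x = φ x := fun _ => rfl
    refine ⟨?_, fun x y ε hε => ?_⟩
    · have h := hc.comp (e.prodCongr e).continuous
      convert h using 2 with a
      exact (hd a.1 a.2).symm
    · have h := (e.prodCongr e).isCompact_preimage.2 (hK (φ x) (φ y) ε hε)
      convert h using 1
      have hcl : ∀ z, φ z ∈ closure (chronHull X'.d {φ x, φ y}) ↔
          z ∈ closure (chronHull X.d {x, y}) := by
        intro z
        rw [← image_pair, ← image_chronHull φ hd]
        have := e.image_closure (chronHull X.d {x, y})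
        change φ '' _ = closure (φ '' _) at this
        rw [← this, φ.injective.mem_set_image]
      ext ⟨a, b⟩
      simp only [mem_inter_iff, mem_ofPred_eq, mem_prod, mem_preimage]
      change _ ↔ ε ≤ X'.d (φ a) (φ b) ∧ φ a ∈ _ ∧ φ b ∈ _
      rw [hd, hcl, hcl]
  rw [continuous_iff_le_induced,
    X.existsUnique_topology.unique key X.topology_compatible]

theorem Isomorphic.exists_isQuasiCorrespondence (h : X.Isomorphic X') (m : ℕ) {ε : ℝ}
    (hε : 0 < ε) : ∃ R, X.IsQuasiCorrespondence X' m ε R := by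
  obtain ⟨f, hf, hd, hs⟩ := h
  obtain ⟨φ, rfl⟩ : ∃ φ : X ≃ X', ⇑φ = f := ⟨Equiv.ofBijective f hf, rfl⟩
  have hd' : ∀ x y, X.d (φ.symm x) (φ.symm y) = X'.d x y := fun x y => by simp [← hd]
  have hφ := continuous_of_dist_eq φ hd
  have hφ' := continuous_of_dist_eq φ.symm hd'
  have hinit : φ '' X.initialPoints m = X'.initialPoints m := by
    ext y; simp [initialPoints, ← hs, ← Equiv.eq_symm_apply]
  have hreg : φ '' X.region m = X'.region m := by
    have := Homeomorph.image_closure ⟨φ, hφ, hφ'⟩ (chronHull X.d (X.initialPoints m))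
    change φ '' _ = closure (φ '' _) at this
    rw [region, image_union, this, image_chronHull φ hd, hinit, region]
  refine ⟨(fun x => (x, φ x)) '' X.region m, ?_, ?_, ?_, ?_, ?_, ?_⟩
  · rintro _ ⟨x, hx, rfl⟩
    exact ⟨hx, hreg ▸ mem_image_of_mem φ hx⟩
  · exact (X.isCompact_region m).image (continuous_id.prodMk hφ)
  · rw [image_image, image_id']
    exact X.epsHull_subset_region hε m
  · rw [image_image, hreg]
    exact X'.epsHull_subset_region hε m
  · refine lt_of_le_of_lt ?_ (ENNReal.ofReal_pos.2 hε)
    refine iSup₂_le fun a ha => iSup₂_le fun b hb => ?_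
    obtain ⟨x, -, rfl⟩ := ha
    obtain ⟨y, -, rfl⟩ := hb
    simp [hd]
  · exact fun k hk => ⟨X.seq k, Or.inr ⟨k, hk, rfl⟩, by simp [hs]⟩

end Isomorphism

/-! ### Approximate correspondences -/

/-- An `(m, ε)` quasi-correspondence without the requirements that the relation be compact and
contained in `Xᵐ × X'ᵐ`. -/
structure IsApproxCorrespondence (X : SequencedLorentzianMetricSpace.{u})
    (X' : SequencedLorentzianMetricSpace.{v}) (m : ℕ) (ε : ℝ) (R : X → X' → Prop) : Prop where
  exists_right : ∀ x ∈ epsHull X.d ε (X.initialPoints m), ∃ x', R x x'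
  exists_left : ∀ x' ∈ epsHull X'.d ε (X'.initialPoints m), ∃ x, R x x'
  abs_sub_lt : ∀ x x' y y', R x x' → R y y' → |X.d x y - X'.d x' y'| < ε
  seq_rel : ∀ k < m, R (X.seq k) (X'.seq k)

section Approx

variable {X : SequencedLorentzianMetricSpace.{u}} {X' : SequencedLorentzianMetricSpace.{v}}

theorem IsQuasiCorrespondence.isApproxCorrespondence {m : ℕ} {ε : ℝ} (hε : 0 < ε)
    {R : Set (X × X')} (h : X.IsQuasiCorrespondence X' m ε R) :
    X.IsApproxCorrespondence X' m ε fun x x' => (x, x') ∈ R where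
  exists_right x hx := by
    obtain ⟨a, ha, rfl⟩ := h.epsHull_subset_fst hx
    exact ⟨a.2, ha⟩
  exists_left x hx := by
    obtain ⟨a, ha, rfl⟩ := h.epsHull_subset_snd hx
    exact ⟨a.1, ha⟩
  abs_sub_lt x x' y y' hx hy := by
    have h1 : ENNReal.ofReal |X.d x y - X'.d x' y'| ≤ distortion X X' R :=
      le_iSup₂_of_le (x, x') hx (le_iSup₂_of_le (y, y') hy le_rfl)
    exact (ENNReal.ofReal_lt_ofReal_iff hε).1 (h1.trans_lt h.distortion_lt)
  seq_rel := h.seq_mem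

theorem IsApproxCorrespondence.symm {m : ℕ} {ε : ℝ} {R : X → X' → Prop}
    (h : X.IsApproxCorrespondence X' m ε R) :
    X'.IsApproxCorrespondence X m ε fun x' x => R x x' where
  exists_right := h.exists_left
  exists_left := h.exists_right
  abs_sub_lt x' x y' y hx hy := by
    rw [abs_sub_comm]
    exact h.abs_sub_lt x x' y y' hx hy
  seq_rel := h.seq_rel

/-- A relation with distortion less than `ε` that relates the first `m` generators sends points
of the hull `I_{2ε}` to points of the hull `I_ε`. -/
theorem IsApproxCorrespondence.mem_epsHull {m : ℕ} {ε : ℝ} {R : X → X' → Prop}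
    (h : X.IsApproxCorrespondence X' m ε R) {x : X} {x' : X'} (hR : R x x')
    (hx : x ∈ epsHull X.d (ε + ε) (X.initialPoints m)) :
    x' ∈ epsHull X'.d ε (X'.initialPoints m) := by
  obtain ⟨_, ⟨k, hk, rfl⟩, _, ⟨l, hl, rfl⟩, h1, h2⟩ := hx
  refine ⟨_, ⟨k, hk, rfl⟩, _, ⟨l, hl, rfl⟩, ?_, ?_⟩
  · linarith [(abs_lt.1 (h.abs_sub_lt _ _ _ _ (h.seq_rel k hk) hR)).2]
  · linarith [(abs_lt.1 (h.abs_sub_lt _ _ _ _ hR (h.seq_rel l hl))).2]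

theorem IsApproxCorrespondence.comp {Y : SequencedLorentzianMetricSpace.{w}} {m : ℕ} {ε : ℝ}
    (hε : 0 < ε) {R : X → Y → Prop} {S : Y → X' → Prop}
    (hR : X.IsApproxCorrespondence Y m ε R) (hS : Y.IsApproxCorrespondence X' m ε S) :
    X.IsApproxCorrespondence X' m (ε + ε) (Relation.Comp R S) where
  exists_right x hx := by
    obtain ⟨p, hp, q, hq, h1, h2⟩ := id hx
    obtain ⟨y, hy⟩ := hR.exists_right x ⟨p, hp, q, hq, by linarith, by linarith⟩
    obtain ⟨x', hx'⟩ := hS.exists_right y (hR.mem_epsHull hy hx)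
    exact ⟨x', y, hy, hx'⟩
  exists_left x' hx' := by
    obtain ⟨p, hp, q, hq, h1, h2⟩ := id hx'
    obtain ⟨y, hy⟩ := hS.exists_left x' ⟨p, hp, q, hq, by linarith, by linarith⟩
    obtain ⟨x, hx⟩ := hR.exists_left y (hS.symm.mem_epsHull hy hx')
    exact ⟨x, y, hx, hy⟩
  abs_sub_lt := by
    rintro x x' y y' ⟨a, h1, h2⟩ ⟨b, h3, h4⟩
    have := hR.abs_sub_lt _ _ _ _ h1 h3
    have := hS.abs_sub_lt _ _ _ _ h2 h4
    linarith [abs_sub_le (X.d x y) (Y.d a b) (X'.d x' y')]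
  seq_rel k hk := ⟨Y.seq k, hR.seq_rel k hk, hS.seq_rel k hk⟩

/-! ### Limits along an ultrafilter -/

theorem eventually_one_div_lt {c : ℝ} (hc : 0 < c) :
    ∀ᶠ n : ℕ in hyperfilter ℕ, 1 / ((n : ℝ) + 1) < c :=
  (tendsto_one_div_add_atTop_nhds_zero_nat.eventually_lt_const hc).filter_mono
    Nat.hyperfilter_le_atTop

/-- Limits of related sequences have equal distances, because the distortion of `R n` tends to
zero. -/
theorem dist_eq_of_tendsto {R : ℕ → X → X' → Prop}
    (hR : ∀ n : ℕ, X.IsApproxCorrespondence X' (n + 1) (1 / ((n : ℝ) + 1)) (R n))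
    {a b : ℕ → X} {a' b' : ℕ → X'} {x y : X} {x' y' : X'}
    (hx : ∀ᶠ n in hyperfilter ℕ, R n (a n) (a' n)) (hy : ∀ᶠ n in hyperfilter ℕ, R n (b n) (b' n))
    (ha : Tendsto a (hyperfilter ℕ) (𝓝 x)) (ha' : Tendsto a' (hyperfilter ℕ) (𝓝 x'))
    (hb : Tendsto b (hyperfilter ℕ) (𝓝 y)) (hb' : Tendsto b' (hyperfilter ℕ) (𝓝 y')) :
    X.d x y = X'.d x' y' := by
  have h1 : Tendsto (fun n => X.d (a n) (b n)) (hyperfilter ℕ) (𝓝 (X.d x y)) :=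
    (X.topology_compatible.1.tendsto (x, y)).comp (ha.prodMk_nhds hb)
  have h2 : Tendsto (fun n => X'.d (a' n) (b' n)) (hyperfilter ℕ) (𝓝 (X'.d x' y')) :=
    (X'.topology_compatible.1.tendsto (x', y')).comp (ha'.prodMk_nhds hb')
  refine eq_of_abs_sub_le_all fun c hc => ?_
  refine le_of_tendsto (h1.sub h2).abs ?_
  filter_upwards [hx, hy, eventually_one_div_lt hc] with n hxn hyn hn
  exact (((hR n).abs_sub_lt _ _ _ _ hxn hyn).trans hn).le

/-- The sequence `u` eventually lies in the diamond of two generators, whose closure is compact. -/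
theorem exists_tendsto_of_approx {R : ℕ → X → X' → Prop}
    (hR : ∀ n : ℕ, X.IsApproxCorrespondence X' (n + 1) (1 / ((n : ℝ) + 1)) (R n)) (x : X) :
    ∃ (x' : X') (u : ℕ → X'), (∀ᶠ n in hyperfilter ℕ, R n x (u n)) ∧
      Tendsto u (hyperfilter ℕ) (𝓝 x') := by
  obtain ⟨k, l, hk, hl⟩ := X.exists_seq_bounds x
  have hlarge : ∀ᶠ n : ℕ in hyperfilter ℕ, k < n + 1 ∧ l < n + 1 := by
    refine Filter.Eventually.filter_mono Nat.hyperfilter_le_atTop ?_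
    filter_upwards [eventually_ge_atTop k, eventually_ge_atTop l] with n h1 h2
    omega
  have hex : ∀ᶠ n in hyperfilter ℕ, ∃ x', R n x x' := by
    filter_upwards [hlarge, eventually_one_div_lt hk, eventually_one_div_lt hl] with n hn h1 h2
    exact (hR n).exists_right x ⟨_, ⟨k, hn.1, rfl⟩, _, ⟨l, hn.2, rfl⟩, h1.le, h2.le⟩
  have : Nonempty X' := ⟨X'.seq 0⟩
  obtain ⟨u, hu⟩ := hex.choice
  have hmem : ∀ᶠ n in hyperfilter ℕ,
      u n ∈ closure {y | 0 < X'.d (X'.seq k) y ∧ 0 < X'.d y (X'.seq l)} := by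
    filter_upwards [hu, hlarge, eventually_one_div_lt hk, eventually_one_div_lt hl]
      with n hun hn h1 h2
    have h3 := (abs_lt.1 ((hR n).abs_sub_lt _ _ _ _ ((hR n).seq_rel k hn.1) hun)).2
    have h4 := (abs_lt.1 ((hR n).abs_sub_lt _ _ _ _ hun ((hR n).seq_rel l hn.2))).2
    exact subset_closure ⟨by linarith, by linarith⟩
  obtain ⟨x', -, hx'⟩ := (X'.isCompact_closure_chronDiamond _ _).ultrafilter_le_nhds'
    ((hyperfilter ℕ).map u) hmem
  exact ⟨x', u, hu, hx'⟩

/-- The ultrafilter limits in both directions are mutually inverse isomorphisms. -/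
theorem isomorphic_of_isApproxCorrespondence
    (h : ∀ (m : ℕ) (ε : ℝ), 1 ≤ m → 0 < ε → ∃ R, X.IsApproxCorrespondence X' m ε R) :
    X.Isomorphic X' := by
  choose R hR using fun n : ℕ =>
    h (n + 1) (1 / ((n : ℝ) + 1)) (Nat.le_add_left 1 n) Nat.one_div_pos_of_nat
  choose φ u hu hφ using exists_tendsto_of_approx hR
  choose ψ v hv hψ using exists_tendsto_of_approx fun n => (hR n).symm
  have hd : ∀ x y, X.d x y = X'.d (φ x) (φ y) := fun x y =>
    dist_eq_of_tendsto hR (hu x) (hu y) tendsto_const_nhds (hφ x) tendsto_const_nhds (hφ y)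
  have hd' : ∀ x y, X.d (ψ x) (ψ y) = X'.d x y := fun x y =>
    dist_eq_of_tendsto hR (hv x) (hv y) (hψ x) tendsto_const_nhds (hψ y) tendsto_const_nhds
  -- `φ` and `ψ` are adjoint for `d` and `d'`; this forces them to be mutually inverse.
  have hadj : ∀ x y, X.d x (ψ y) = X'.d (φ x) y := fun x y =>
    dist_eq_of_tendsto hR (hu x) (hv y) tendsto_const_nhds (hφ x) (hψ y) tendsto_const_nhds
  have hadj' : ∀ x y, X.d (ψ y) x = X'.d y (φ x) := fun x y =>
    dist_eq_of_tendsto hR (hv y) (hu x) (hψ y) tendsto_const_nhds tendsto_const_nhds (hφ x)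
  have hleft : Function.LeftInverse ψ φ := fun x =>
    X.eq_of_dist_eq (fun z => by rw [hadj', ← hd]) (fun z => by rw [hadj, ← hd])
  have hright : Function.RightInverse ψ φ := fun x =>
    X'.eq_of_dist_eq (fun z => by rw [← hadj, hd']) (fun z => by rw [← hadj', hd'])
  refine ⟨φ, ⟨hleft.injective, hright.surjective⟩, fun x y => (hd x y).symm, fun k => ?_⟩
  have hseq : ∀ᶠ n in hyperfilter ℕ, R n (X.seq k) (X'.seq k) := by
    refine Filter.Eventually.filter_mono Nat.hyperfilter_le_atTop ?_
    filter_upwards [eventually_ge_atTop k] with n hn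
    exact (hR n).seq_rel k (by omega)
  refine X'.eq_of_dist_eq (fun z => ?_) (fun z => ?_)
  · rw [← hadj]
    exact dist_eq_of_tendsto hR hseq (hv z) tendsto_const_nhds tendsto_const_nhds (hψ z)
      tendsto_const_nhds
  · rw [← hadj']
    exact dist_eq_of_tendsto hR (hv z) hseq (hψ z) tendsto_const_nhds tendsto_const_nhds
      tendsto_const_nhds

end Approx

end SequencedLorentzianMetricSpace

end LorentzianGH

theorem mainTheorem2 :
    (∀ (X : LorentzianGH.SequencedLorentzianMetricSpace.{u})
        (X' : LorentzianGH.SequencedLorentzianMetricSpace.{v}),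
      X.Isomorphic X' ↔
        ∀ (m : ℕ) (ε : ℝ), 1 ≤ m → 0 < ε → ∃ R, X.IsQuasiCorrespondence X' m ε R) ∧
    (∀ (Xs : ℕ → LorentzianGH.SequencedLorentzianMetricSpace.{w})
        (X : LorentzianGH.SequencedLorentzianMetricSpace.{u})
        (X' : LorentzianGH.SequencedLorentzianMetricSpace.{v}),
      LorentzianGH.SequencedLorentzianMetricSpace.GHConverges Xs X →
        LorentzianGH.SequencedLorentzianMetricSpace.GHConverges Xs X' →
          X.Isomorphic X') := by
  refine ⟨fun X X' => ⟨fun h m ε _ hε => h.exists_isQuasiCorrespondence m hε, fun h => ?_⟩,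
    fun Xs X X' hX hX' => ?_⟩
  · refine LorentzianGH.SequencedLorentzianMetricSpace.isomorphic_of_isApproxCorrespondence
      fun m ε hm hε => ?_
    obtain ⟨R, hR⟩ := h m ε hm hε
    exact ⟨_, hR.isApproxCorrespondence hε⟩
  · refine LorentzianGH.SequencedLorentzianMetricSpace.isomorphic_of_isApproxCorrespondence
      fun m ε hm hε => ?_
    obtain ⟨n₁, h₁⟩ := hX m (ε / 2) hm (half_pos hε)
    obtain ⟨n₂, h₂⟩ := hX' m (ε / 2) hm (half_pos hε)
    obtain ⟨R, hR⟩ := h₁ (max n₁ n₂) (le_max_left _ _)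
    obtain ⟨S, hS⟩ := h₂ (max n₁ n₂) (le_max_right _ _)
    have h := (hR.isApproxCorrespondence (half_pos hε)).symm.comp (half_pos hε)
      (hS.isApproxCorrespondence (half_pos hε))
    rw [add_halves] at h
    exact ⟨_, h⟩
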